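/- **Setting.** An instance is a finite connected simple graph $G=(V,E)$ with $n=|V|\ge 1$ nodes, together with pairwise distinct identifiers $\mathsf{id}(v)\in\{1,\dots,n^c\}$, $v\in V$, where $c\ge 1$ is a fixed integer. A certificate is a finite bit string. A verifier is an algorithm (a computable function) that, given the identifier $\mathsf{id}(v)$ of a node $v$, the certificate $c(v)$ of $v$, and the multiset of the certificates $c(w)$ of the neighbors $w$ of $v$, outputs accept or reject. A proof-labeling scheme (PLS) for a class $\mathcal F$ of graphs, with certificates of at most $s(n)$ bits on $n$-node graphs, consists of a verifier such that for every instance $(G,\mathsf{id})$: * (completeness) if $G\in\mathcal F$, then certificates of at most $s(n)$ bits can be assigned to the nodes so that the verifier accepts at every node; * (soundness) if $G\notin\mathcal F$, then for every assignment of certificates, of whatever size, the verifier rejects in at least one node. **Theorem.** The class of induced-$P_4$-free graphs (the graphs without a path on four vertices as an induced subgraph, i.e. the cographs) can be certified with a PLS using $O(\log n)$-bit certificates in $n$-node graphs. More precisely, there is a verifier such that, for every integer $c\ge 1$, there is a function $s:\mathbb N\to\mathbb N$ with $s(n)=O(\log n)$ as $n\to\infty$ (the implied constant may depend on $c$) for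 which this verifier gives a PLS for the class of induced-$P_4$-free graphs with certificates of at most $s(n)$ bits on $n$-node graphs with identifiers in $\{1,\dots,n^c\}$. -/

import Mathlib

open Asymptotics Filter

universe u

/-- The (induced) `P₄`-free graphs: no path on four vertices is an induced subgraph of `G`. -/
def InducedP4Free (V : Type u) (G : SimpleGraph V) : Prop :=
  ¬ (SimpleGraph.pathGraph 4).IsIndContained G

namespace PLS

/-- A certificate is a finite bit string; its size is its length. -/
abbrev Certificate : Type := List Bool

/-- Identifiers are pairwise distinct integers in `[1, n ^ c]`, where `n` is the number of nodes. -/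
def IsIdAssignment {V : Type u} [Fintype V] (c : ℕ) (ident : V → ℕ) : Prop :=
  Function.Injective ident ∧ ∀ v, 1 ≤ ident v ∧ ident v ≤ Fintype.card V ^ c

/-- The verifier run by every node. Its input is the identifier of the node, the certificate of the
node, and the certificates received from its neighbors, one from each of them (a multiset: the
outcome does not depend on the order in which they arrive). Its output is `true` for "accept" and
`false` for "reject". It is an algorithm: the output is a computable function of the input, the
received certificates being presented as a list in any order. -/
structure Verifier where
  output : ℕ → Certificate → Multiset Certificate → Bool
  computable : Computable fun x : ℕ × Certificate × List Certificate =>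
    output x.1 x.2.1 (x.2.2 : Multiset Certificate)

open Classical in
/-- The certificates that `v` receives in the single round of communication. -/
noncomputable def received {V : Type u} [Fintype V] (G : SimpleGraph V) (cert : V → Certificate)
    (v : V) : Multiset Certificate :=
  (Finset.univ.filter fun w => G.Adj v w).val.map cert

/-- The node `v` accepts. -/
def Verifier.AcceptsAt (A : Verifier) {V : Type u} [Fintype V] (G : SimpleGraph V) (ident : V → ℕ)
    (cert : V → Certificate) (v : V) : Prop :=
  A.output (ident v) (cert v) (received G cert v) = true

/-- `A` is the verifier of a proof-labeling scheme for the graph class `P`, with certificates of at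
most `s n` bits on `n`-node graphs. The instances are the connected finite simple graphs with
identifiers in `[1, n ^ c]`. Completeness: if the graph is in `P` then the prover can assign
certificates of at most `s n` bits such that all nodes accept. Soundness: if the graph is not in
`P` then for every certificate assignment (of whatever size) some node rejects. -/
def Verifier.Certifies (A : Verifier) (c : ℕ) (s : ℕ → ℕ)
    (P : (V : Type u) → SimpleGraph V → Prop) : Prop :=
  ∀ (V : Type u) [Fintype V] (G : SimpleGraph V) (ident : V → ℕ),
    G.Connected → IsIdAssignment c ident →
      (P V G → ∃ cert : V → Certificate,
        (∀ v, (cert v).length ≤ s (Fintype.card V)) ∧ ∀ v, A.AcceptsAt G ident cert v) ∧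
      (¬ P V G → ∀ cert : V → Certificate, ∃ v, ¬ A.AcceptsAt G ident cert v)

end PLS

/-!
By a theorem of Seinsche, an induced-`P₄`-free graph on at least two vertices, or its complement, is
disconnected. So the vertices of a connected one split into two sides with all edges between them,
and each node receives the certificates of the whole opposite side. By recursion the graph also has
a permutation model: points of the plane, with coordinates below `n`, such that two vertices are
adjacent if and only if the coordinates order their points oppositely.

A certificate consists of the point of the node, its side, its identifier, its degree inside its
side, and, for each of the sides, its size and the identifier of a node adjacent to all of it. By
connectivity, neighbors that agree on the latter numbers agree globally. Then each side has a node
adjacent to all of it, and comparing sizes shows that the graph is a join of the two sides. Adjacent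
nodes of one side check that their points are in crossing position, and the opposite side, which
sees all the points, checks that the degrees leave no room for further crossings. Hence the points
determine the edges inside each side, and the nodes of the opposite side find every induced `P₄`;
an induced `P₄` cannot visit both sides of a join.
-/

section InducedP4

variable {V : Type*} {G : SimpleGraph V} {a b c d : V}

/-- The vertices `a`, `b`, `c`, `d` induce in `G` a path with these consecutive vertices. They are
then pairwise distinct: see `IsInducedP4.ne`. -/
def IsInducedP4 (G : SimpleGraph V) (a b c d : V) : Prop :=
  G.Adj a b ∧ G.Adj b c ∧ G.Adj c d ∧ ¬ G.Adj a c ∧ ¬ G.Adj b d ∧ ¬ G.Adj a d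

theorem IsInducedP4.ne (h : IsInducedP4 G a b c d) : a ≠ c ∧ b ≠ d ∧ a ≠ d := by
  obtain ⟨hab, -, hcd, hac, -, had⟩ := h
  refine ⟨?_, ?_, ?_⟩ <;> rintro rfl
  exacts [had hcd, had hab, hac hcd.symm]

theorem IsInducedP4.isIndContained (h : IsInducedP4 G a b c d) :
    (SimpleGraph.pathGraph 4).IsIndContained G := by
  obtain ⟨hac', hbd', had'⟩ := h.ne
  obtain ⟨hab, hbc, hcd, hac, hbd, had⟩ := h
  refine ⟨⟨⟨![a, b, c, d], fun i j hij => ?_⟩, fun {i j} => ?_⟩⟩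
  · have hab' := hab.ne
    have hbc' := hbc.ne
    have hcd' := hcd.ne
    fin_cases i <;> fin_cases j <;> simp_all [eq_comm]
  · change G.Adj (![a, b, c, d] i) (![a, b, c, d] j) ↔ _
    fin_cases i <;> fin_cases j <;> simp_all [SimpleGraph.pathGraph_adj, G.adj_comm]

theorem inducedP4Free_iff : InducedP4Free V G ↔ ∀ a b c d, ¬ IsInducedP4 G a b c d := by
  refine ⟨fun hG a b c d h => hG h.isIndContained, ?_⟩
  rintro h ⟨f⟩
  exact h (f 0) (f 1) (f 2) (f 3) (by simp [IsInducedP4, SimpleGraph.pathGraph_adj])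

/-- The complement of the path `a`, `b`, `c`, `d` is the path `c`, `a`, `d`, `b`. -/
theorem IsInducedP4.of_compl (h : IsInducedP4 Gᶜ a b c d) : IsInducedP4 G c a d b := by
  obtain ⟨hac, hbd, had⟩ := h.ne
  simp only [IsInducedP4, SimpleGraph.compl_adj, not_and, not_not] at h
  obtain ⟨hab, hbc, hcd, hac', hbd', had'⟩ := h
  exact ⟨(hac' hac).symm, had' had, (hbd' hbd).symm, hcd.2, hab.2, fun h => hbc.2 h.symm⟩

theorem InducedP4Free.compl (hG : InducedP4Free V G) : InducedP4Free V Gᶜ :=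
  inducedP4Free_iff.2 fun _ _ _ _ h => inducedP4Free_iff.1 hG _ _ _ _ h.of_compl

/-- The complement of a path on four vertices is connected, so an induced path cannot visit both
sides of a join. -/
theorem IsInducedP4.map_eq {α : Type*} {f : V → α} (hf : ∀ u v, f u ≠ f v → G.Adj u v)
    (h : IsInducedP4 G a b c d) : f b = f a ∧ f c = f a ∧ f d = f a := by
  obtain ⟨-, -, -, hac, hbd, had⟩ := h
  have eq_of_not_adj {u v : V} (huv : ¬ G.Adj u v) : f u = f v := not_imp_comm.1 (hf u v) huv
  have hda := (eq_of_not_adj had).symm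
  exact ⟨(eq_of_not_adj hbd).trans hda, (eq_of_not_adj hac).symm, hda⟩

end InducedP4

theorem eq_of_forall_adj_eq {V α : Type*} {G : SimpleGraph V} (hG : G.Preconnected) {f : V → α}
    (hf : ∀ u v, G.Adj u v → f u = f v) (u v : V) : f u = f v := by
  obtain ⟨p⟩ := hG u v
  induction p with
  | nil => rfl
  | cons huv _ ih => exact (hf _ _ huv).trans ih

section Seinsche

variable {V : Type*} [DecidableEq V] {G : SimpleGraph V} {S A : Finset V} {v w : V}

/-- `A` is a nonempty proper part of `S` and `G` has no edge between `A` and the rest of `S`; so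
`A` witnesses that the subgraph of `G` induced on `S` is disconnected. -/
structure IsDetached (G : SimpleGraph V) (S A : Finset V) : Prop where
  nonempty : A.Nonempty
  ssubset : A ⊂ S
  not_adj : ∀ a ∈ A, ∀ b ∈ S \ A, ¬ G.Adj a b

theorem IsDetached.sdiff (h : IsDetached G S A) : IsDetached G S (S \ A) where
  nonempty := Finset.sdiff_nonempty.2 h.ssubset.not_subset
  ssubset := Finset.sdiff_ssubset h.ssubset.subset h.nonempty
  not_adj a ha b hb hab := by
    rw [Finset.sdiff_sdiff_eq_self h.ssubset.subset] at hb
    exact h.not_adj b hb a ha hab.symm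

theorem IsDetached.adj_of_compl (h : IsDetached Gᶜ S A) {a b : V} (ha : a ∈ A) (hb : b ∈ S \ A) :
    G.Adj a b := by
  by_contra hab
  exact h.not_adj a ha b hb ⟨ne_of_mem_of_not_mem ha (Finset.mem_sdiff.1 hb).2, hab⟩

theorem isDetached_singleton (hv : v ∉ S) (hS : S.Nonempty) (h : ∀ w ∈ S, ¬ G.Adj v w) :
    IsDetached G (insert v S) {v} where
  nonempty := Finset.singleton_nonempty v
  ssubset := by
    obtain ⟨w, hw⟩ := hS
    exact Finset.ssubset_iff_of_subset (by simp) |>.2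
      ⟨w, Finset.mem_insert_of_mem hw, by simpa using ne_of_mem_of_not_mem hw hv⟩
  not_adj := by simpa using fun w hw _ => h w hw

/-- Let `v` miss `w ∈ A`. If `v` has a neighbor `z` outside `A`, then an edge `x y` of `A` with `v`
adjacent to `x` only would complete a path `z`, `v`, `x`, `y`, so the part of `A` not adjacent to
`v` is detached. Otherwise the complement of `A` still is. -/
theorem IsDetached.exists_insert (hG : InducedP4Free V G) (h : IsDetached G S A) (hv : v ∉ S)
    (hw : w ∈ S) (hvw : ¬ G.Adj v w) : ∃ A', IsDetached G (insert v S) A' := by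
  classical
  wlog hwA : w ∈ A generalizing A
  · exact this h.sdiff (Finset.mem_sdiff.2 ⟨hw, hwA⟩)
  by_cases hz : ∃ z ∈ S \ A, G.Adj v z
  · obtain ⟨z, hz, hvz⟩ := hz
    have not_adj_of_adj : ∀ x ∈ A, ∀ y ∈ A, G.Adj v x → ¬ G.Adj v y → ¬ G.Adj x y :=
      fun x hx y hy hvx hvy hxy => inducedP4Free_iff.1 hG z v x y ⟨hvz.symm, hvx, hxy,
        fun hzx => h.not_adj x hx z hz hzx.symm, hvy, fun hzy => h.not_adj y hy z hz hzy.symm⟩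
    refine ⟨A.filter fun x => ¬ G.Adj v x, ⟨w, by simp [hwA, hvw]⟩, ?_, fun a ha b hb => ?_⟩
    · exact (Finset.filter_subset _ _).trans_ssubset
        (h.ssubset.trans_subset (Finset.subset_insert v S))
    · simp only [Finset.mem_filter, Finset.mem_sdiff, Finset.mem_insert] at ha hb
      obtain ⟨rfl | hbS, hb⟩ := hb
      · exact fun hab => ha.2 hab.symm
      · by_cases hbA : b ∈ A
        · exact fun hab => not_adj_of_adj b hbA a ha.1 (by tauto) ha.2 hab.symm
        · exact h.not_adj a ha.1 b (Finset.mem_sdiff.2 ⟨hbS, hbA⟩)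
  · push Not at hz
    refine ⟨S \ A, h.sdiff.nonempty, h.sdiff.ssubset.trans (Finset.ssubset_insert hv),
      fun a ha b hb => ?_⟩
    obtain ⟨hb, hbA⟩ := Finset.mem_sdiff.1 hb
    obtain rfl | hbS := Finset.mem_insert.1 hb
    · exact fun hab => hz a ha hab.symm
    · exact h.sdiff.not_adj a ha b (Finset.mem_sdiff.2 ⟨hbS, hbA⟩)

/-- Seinsche's theorem, by adding the vertices of `S` one at a time. A new vertex that is adjacent
to some but not all of the others preserves a detached part of `G` or of `Gᶜ`, up to changing it. -/
theorem InducedP4Free.exists_isDetached (hG : InducedP4Free V G) (hS : S.Nontrivial) :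
    ∃ A, IsDetached G S A ∨ IsDetached Gᶜ S A := by
  induction S using Finset.induction_on with
  | empty => simp at hS
  | insert v S hv ih =>
    have hne : S.Nonempty := by
      rw [Finset.nonempty_iff_ne_empty]
      rintro rfl
      simp at hS
    by_cases hadj : ∀ w ∈ S, ¬ G.Adj v w
    · exact ⟨{v}, .inl (isDetached_singleton hv hne hadj)⟩
    by_cases hnadj : ∀ w ∈ S, ¬ Gᶜ.Adj v w
    · exact ⟨{v}, .inr (isDetached_singleton hv hne hnadj)⟩
    push Not at hadj hnadj
    obtain ⟨x, hx, hvx⟩ := hadj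
    obtain ⟨y, hy, hvy⟩ := hnadj
    have hxy : x ≠ y := by rintro rfl; exact hvy.2 hvx
    obtain ⟨A, h | h⟩ := ih ⟨x, hx, y, hy, hxy⟩
    · exact (h.exists_insert hG hv hy hvy.2).imp fun _ => .inl
    · exact (h.exists_insert hG.compl hv hx (by simp [hvx])).imp fun _ => .inr

theorem InducedP4Free.exists_join {V : Type*} [Finite V] [Nontrivial V] {G : SimpleGraph V}
    (hG : InducedP4Free V G) (hconn : G.Preconnected) :
    ∃ side : V → Bool, Function.Surjective side ∧ ∀ u v, side u ≠ side v → G.Adj u v := by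
  classical
  cases nonempty_fintype V
  obtain ⟨A, h⟩ := hG.exists_isDetached (S := Finset.univ)
    (by simpa [Finset.Nontrivial] using Set.nontrivial_univ)
  obtain ⟨a, ha⟩ : A.Nonempty := h.elim (·.nonempty) (·.nonempty)
  obtain ⟨b, -, hb⟩ := Finset.exists_of_ssubset (h.elim (·.ssubset) (·.ssubset))
  obtain h | h := h
  · have mem_iff_of_adj (u v : V) (huv : G.Adj u v) : (u ∈ A) = (v ∈ A) := by
      have huv' := h.not_adj u
      have hvu' := h.not_adj v
      simp only [Finset.mem_sdiff, Finset.mem_univ, true_and, eq_iff_iff] at huv' hvu' ⊢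
      exact ⟨fun hu => by_contra fun hv => huv' hu v hv huv,
        fun hv => by_contra fun hu => hvu' hv u hu huv.symm⟩
    exact absurd (eq_of_forall_adj_eq hconn mem_iff_of_adj a b ▸ ha) hb
  · refine ⟨fun v => decide (v ∈ A), ?_, fun u v huv => ?_⟩
    · rintro (_ | _)
      exacts [⟨b, by simpa using hb⟩, ⟨a, by simpa using ha⟩]
    · by_cases hu : u ∈ A
      · exact h.adj_of_compl hu (by simpa [hu] using huv)
      · exact (h.adj_of_compl (by simpa [hu] using huv) (by simpa using hu)).symm

end Seinsche

section PermutationModel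

/-- Two points are adjacent when the two coordinates order them oppositely. Viewing a point
`(x, y)` as a segment from `x` to `y` between two parallel lines, adjacent segments are those that
cross, so the graphs represented by points in this way are the permutation graphs. -/
def crossingGraph (α β : Type*) [Preorder α] [Preorder β] : SimpleGraph (α × β) where
  Adj p q := (p.1 < q.1 ∧ q.2 < p.2) ∨ (q.1 < p.1 ∧ p.2 < q.2)
  symm := ⟨fun _ _ => Or.symm⟩
  loopless := ⟨fun p h => by simp at h⟩

instance {α β : Type*} [Preorder α] [Preorder β] [DecidableLT α] [DecidableLT β] :
    DecidableRel (crossingGraph α β).Adj :=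
  fun p q => inferInstanceAs (Decidable ((p.1 < q.1 ∧ q.2 < p.2) ∨ (q.1 < p.1 ∧ p.2 < q.2)))

variable {V : Type*} {G : SimpleGraph V} {S A B : Finset V} {p q : V → ℕ × ℕ}

/-- The points `p v` with coordinates below `#S` represent the subgraph of `G` induced on `S` as a
permutation graph. Coordinates may coincide. -/
structure IsPermutationModel (G : SimpleGraph V) (S : Finset V) (p : V → ℕ × ℕ) : Prop where
  fst_lt : ∀ v ∈ S, (p v).1 < S.card
  snd_lt : ∀ v ∈ S, (p v).2 < S.card
  adj_iff : ∀ u ∈ S, ∀ v ∈ S, G.Adj u v ↔ (crossingGraph ℕ ℕ).Adj (p u) (p v)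

theorem isPermutationModel_zero (hS : ¬ S.Nontrivial) : IsPermutationModel G S 0 where
  fst_lt v hv := Finset.card_pos.2 ⟨v, hv⟩
  snd_lt v hv := Finset.card_pos.2 ⟨v, hv⟩
  adj_iff u hu v hv := by
    obtain rfl := Set.not_nontrivial_iff.1 hS hu hv
    simp

/-- The second model is placed to the right of the first one, so only the vertical shifts decide
which points of the two models are adjacent. -/
theorem IsPermutationModel.union [DecidableEq V] (hAB : Disjoint A B)
    (hA : IsPermutationModel G A p) (hB : IsPermutationModel G B q) {i j : ℕ} (hi : i ≤ B.card)
    (hj : j ≤ A.card) (hadj : ∀ a ∈ A, ∀ b ∈ B, G.Adj a b ↔ j + (q b).2 < i + (p a).2) :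
    IsPermutationModel G (A ∪ B) fun v => if v ∈ A then (0, i) + p v else (A.card, j) + q v := by
  have notMem_A : ∀ v ∈ B, v ∉ A := fun v hv hv' => Finset.disjoint_left.1 hAB hv' hv
  have adj_iff_of_mem : ∀ a ∈ A, ∀ b ∈ B,
      G.Adj a b ↔ (crossingGraph ℕ ℕ).Adj ((0, i) + p a) ((A.card, j) + q b) := fun a ha b hb => by
    have := hA.fst_lt a ha
    simp only [hadj a ha b hb, crossingGraph, Prod.fst_add, Prod.snd_add]
    omega
  refine ⟨fun v hv => ?_, fun v hv => ?_, fun u hu v hv => ?_⟩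
  · rw [Finset.card_union_of_disjoint hAB]
    obtain hv | hv := Finset.mem_union.1 hv
    · simpa [hv] using Nat.lt_add_right _ (hA.fst_lt v hv)
    · simpa [notMem_A v hv] using hB.fst_lt v hv
  · rw [Finset.card_union_of_disjoint hAB]
    obtain hv | hv := Finset.mem_union.1 hv
    · simpa [hv, add_comm A.card] using add_lt_add_of_le_of_lt hi (hA.snd_lt v hv)
    · simpa [notMem_A v hv] using add_lt_add_of_le_of_lt hj (hB.snd_lt v hv)
  · obtain hu | hu := Finset.mem_union.1 hu <;> obtain hv | hv := Finset.mem_union.1 hv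
    · simpa [hu, hv, crossingGraph] using hA.adj_iff u hu v hv
    · simpa only [hu, notMem_A v hv, if_true, if_false] using adj_iff_of_mem u hu v hv
    · simpa only [hv, notMem_A u hu, if_true, if_false, SimpleGraph.adj_comm]
        using adj_iff_of_mem v hv u hu
    · simpa [notMem_A u hu, notMem_A v hv, crossingGraph] using hB.adj_iff u hu v hv

theorem InducedP4Free.exists_isPermutationModel (hG : InducedP4Free V G) (S : Finset V) :
    ∃ p, IsPermutationModel G S p := by
  classical
  induction S using Finset.strongInduction with
  | H S ih =>
    by_cases hS : S.Nontrivial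
    · obtain ⟨A, h⟩ := hG.exists_isDetached hS
      have hA : A ⊂ S := h.elim (·.ssubset) (·.ssubset)
      have hB : S \ A ⊂ S := h.elim (·.sdiff.ssubset) (·.sdiff.ssubset)
      obtain ⟨p, hp⟩ := ih A hA
      obtain ⟨q, hq⟩ := ih (S \ A) hB
      rw [← Finset.union_sdiff_of_subset hA.subset]
      obtain h | h := h
      · refine ⟨_, hp.union Finset.disjoint_sdiff hq (Nat.zero_le _) le_rfl fun a ha b hb => ?_⟩
        have := hp.snd_lt a ha
        simp only [h.not_adj a ha b hb, false_iff]
        omega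
      · refine ⟨_, hp.union Finset.disjoint_sdiff hq le_rfl (Nat.zero_le _) fun a ha b hb => ?_⟩
        have := hq.snd_lt b hb
        simp only [h.adj_of_compl ha hb, true_iff]
        omega
    · exact ⟨0, isPermutationModel_zero hS⟩

end PermutationModel

section Computability

variable {α β : Type*} [Primcodable α] [Primcodable β] {f : α → List β} {p : α → β → Prop}

theorem primrecPred_forall_mem (hf : Primrec f) (hp : PrimrecRel p) :
    PrimrecPred fun a => ∀ b ∈ f a, p a b :=
  (PrimrecRel.forall_mem_list (R := fun b a => p a b) (hp.comp Primrec.snd Primrec.fst)).comp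
    hf Primrec.id

theorem primrecPred_exists_mem (hf : Primrec f) (hp : PrimrecRel p) :
    PrimrecPred fun a => ∃ b ∈ f a, p a b :=
  (PrimrecRel.exists_mem_list (R := fun b a => p a b) (hp.comp Primrec.snd Primrec.fst)).comp
    hf Primrec.id

theorem primrec_filter [DecidableRel p] (hf : Primrec f) (hp : PrimrecRel p) :
    Primrec fun a => (f a).filter fun b => p a b :=
  (PrimrecRel.listFilter (R := fun b a => p a b) (hp.comp Primrec.snd Primrec.fst)).comp
    hf Primrec.id

theorem primrecRel_crossingGraph : PrimrecRel (crossingGraph ℕ ℕ).Adj := by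
  have lt {f g : (ℕ × ℕ) × (ℕ × ℕ) → ℕ} (hf : Primrec f) (hg : Primrec g) :
      PrimrecPred fun x => f x < g x := Primrec.nat_lt.comp hf hg
  have fst₁ : Primrec fun x : (ℕ × ℕ) × (ℕ × ℕ) => x.1.1 := Primrec.fst.comp Primrec.fst
  have snd₁ : Primrec fun x : (ℕ × ℕ) × (ℕ × ℕ) => x.1.2 := Primrec.snd.comp Primrec.fst
  have fst₂ : Primrec fun x : (ℕ × ℕ) × (ℕ × ℕ) => x.2.1 := Primrec.fst.comp Primrec.snd
  have snd₂ : Primrec fun x : (ℕ × ℕ) × (ℕ × ℕ) => x.2.2 := Primrec.snd.comp Primrec.snd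
  exact ((lt fst₁ fst₂).and (lt snd₂ snd₁)).or ((lt fst₂ fst₁).and (lt snd₁ snd₂))

theorem primrecPred_isInducedP4 {G : SimpleGraph β} (hG : PrimrecRel G.Adj) {a b c d : α → β}
    (ha : Primrec a) (hb : Primrec b) (hc : Primrec c) (hd : Primrec d) :
    PrimrecPred fun x => IsInducedP4 G (a x) (b x) (c x) (d x) :=
  .and (hG.comp ha hb) <| .and (hG.comp hb hc) <| .and (hG.comp hc hd) <|
    .and (hG.comp ha hc).not <| .and (hG.comp hb hd).not (hG.comp ha hd).not

theorem primrecPred_forall_not_isInducedP4 {G : SimpleGraph β} (hG : PrimrecRel G.Adj)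
    (hf : Primrec f) :
    PrimrecPred fun x => ∀ a ∈ f x, ∀ b ∈ f x, ∀ c ∈ f x, ∀ d ∈ f x, ¬ IsInducedP4 G a b c d := by
  have pred₃ : PrimrecPred fun y : ((α × β) × β) × β =>
      ∀ d ∈ f y.1.1.1, ¬ IsInducedP4 G y.1.1.2 y.1.2 y.2 d :=
    primrecPred_forall_mem (hf.comp (Primrec.fst.comp (Primrec.fst.comp Primrec.fst)))
      (primrecPred_isInducedP4 hG
        (Primrec.snd.comp (Primrec.fst.comp (Primrec.fst.comp Primrec.fst)))
        (Primrec.snd.comp (Primrec.fst.comp Primrec.fst)) (Primrec.snd.comp Primrec.fst)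
        Primrec.snd).not
  have pred₂ : PrimrecPred fun y : (α × β) × β =>
      ∀ c ∈ f y.1.1, ∀ d ∈ f y.1.1, ¬ IsInducedP4 G y.1.2 y.2 c d :=
    primrecPred_forall_mem (hf.comp (Primrec.fst.comp Primrec.fst)) pred₃
  have pred₁ : PrimrecPred fun y : α × β =>
      ∀ b ∈ f y.1, ∀ c ∈ f y.1, ∀ d ∈ f y.1, ¬ IsInducedP4 G y.2 b c d :=
    primrecPred_forall_mem (hf.comp Primrec.fst) pred₂
  exact primrecPred_forall_mem hf pred₁

end Computability

namespace PLS

/-- The content of a certificate of the scheme. -/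
structure Label where
  /-- The identifier of a node that is adjacent to all nodes of the given side of the join. -/
  hub : Bool → ℕ
  /-- The number of nodes on the side opposite to the given one. -/
  count : Bool → ℕ
  /-- The side of the node in the join. -/
  side : Bool
  ident : ℕ
  /-- The number of neighbors of the node on its own side. -/
  degree : ℕ
  /-- The point of the node in a permutation model of the graph. -/
  point : ℕ × ℕ

variable {L : Label} {k : ℕ}

namespace Label

/-- A label as a tuple, from which labels inherit their encoding by numbers. -/
def equivProd : Label ≃ ((ℕ × ℕ) × (ℕ × ℕ)) × (Bool × ℕ) × ℕ × (ℕ × ℕ) where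
  toFun L := (((L.hub false, L.hub true), (L.count false, L.count true)),
    (L.side, L.ident), L.degree, L.point)
  invFun x := ⟨fun b => cond b x.1.1.2 x.1.1.1, fun b => cond b x.1.2.2 x.1.2.1,
    x.2.1.1, x.2.1.2, x.2.2.1, x.2.2.2⟩
  left_inv L := by
    have cond_eq (f : Bool → ℕ) : (fun b => cond b (f true) (f false)) = f := by
      funext b
      cases b <;> rfl
    simp only [cond_eq]
  right_inv _ := rfl

instance : Primcodable Label := .ofEquiv _ equivProd

instance : Inhabited Label := ⟨equivProd.symm default⟩

theorem primrec_equivProd : Primrec equivProd := Primrec.of_equiv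

theorem primrec_hub : Primrec₂ hub := by
  have h : Primrec fun L : Label => (L.hub false, L.hub true) :=
    Primrec.fst.comp (Primrec.fst.comp primrec_equivProd)
  exact (Primrec.cond Primrec.snd (Primrec.snd.comp (h.comp Primrec.fst))
    (Primrec.fst.comp (h.comp Primrec.fst))).of_eq fun ⟨L, b⟩ => by cases b <;> rfl

theorem primrec_count : Primrec₂ count := by
  have h : Primrec fun L : Label => (L.count false, L.count true) :=
    Primrec.snd.comp (Primrec.fst.comp primrec_equivProd)
  exact (Primrec.cond Primrec.snd (Primrec.snd.comp (h.comp Primrec.fst))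
    (Primrec.fst.comp (h.comp Primrec.fst))).of_eq fun ⟨L, b⟩ => by cases b <;> rfl

theorem primrec_side : Primrec side :=
  Primrec.fst.comp (Primrec.fst.comp (Primrec.snd.comp primrec_equivProd))

theorem primrec_ident : Primrec ident :=
  Primrec.snd.comp (Primrec.fst.comp (Primrec.snd.comp primrec_equivProd))

theorem primrec_degree : Primrec degree :=
  Primrec.fst.comp (Primrec.snd.comp (Primrec.snd.comp primrec_equivProd))

theorem primrec_point : Primrec point :=
  Primrec.snd.comp (Primrec.snd.comp (Primrec.snd.comp primrec_equivProd))

end Label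

theorem natPair_lt_two_pow {a b k : ℕ} (ha : a < 2 ^ k) (hb : b < 2 ^ k) :
    Nat.pair a b < 2 ^ (2 * k) := by
  refine (Nat.pair_lt_max_add_one_sq a b).trans_le ?_
  rw [mul_comm, pow_mul]
  exact Nat.pow_le_pow_left (max_lt ha hb) 2

theorem Label.encode_lt (hk : 1 ≤ k) (hhub : ∀ b, L.hub b < 2 ^ k)
    (hcount : ∀ b, L.count b < 2 ^ k) (hident : L.ident < 2 ^ k) (hdegree : L.degree < 2 ^ k)
    (hfst : L.point.1 < 2 ^ k) (hsnd : L.point.2 < 2 ^ k) : Encodable.encode L < 2 ^ (16 * k) := by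
  have mono {i j m : ℕ} (hij : i ≤ j) (hm : m < 2 ^ i) : m < 2 ^ j :=
    hm.trans_le (Nat.pow_le_pow_right two_pos hij)
  have hside : Encodable.encode L.side < 2 ^ k := mono hk (by cases L.side <;> decide)
  have hcommon := natPair_lt_two_pow (natPair_lt_two_pow (hhub false) (hhub true))
    (natPair_lt_two_pow (hcount false) (hcount true))
  have hown := natPair_lt_two_pow (mono (by lia) (natPair_lt_two_pow hside hident))
    (natPair_lt_two_pow (mono (by lia) hdegree) (natPair_lt_two_pow hfst hsnd))
  exact mono (by lia) (natPair_lt_two_pow (mono (by lia) hcommon) hown)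

/-- The number with the given binary digits, the least significant one first. -/
def Certificate.toNat (l : Certificate) : ℕ := l.foldr Nat.bit 0

theorem Certificate.toNat_bits (n : ℕ) : Certificate.toNat n.bits = n := by
  induction n using Nat.binaryRec' with
  | zero => rfl
  | bit b n h ih => rw [Nat.bits_append_bit n b h, toNat, List.foldr_cons, ← toNat, ih]

theorem Certificate.primrec_toNat : Primrec Certificate.toNat := by
  have hbit : Primrec₂ Nat.bit :=
    (Primrec.cond Primrec.fst (Primrec.nat_double_succ.comp Primrec.snd)
      (Primrec.nat_double.comp Primrec.snd)).of_eq fun ⟨b, n⟩ => by cases b <;> rfl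
  exact Primrec.list_foldr Primrec.id (Primrec.const 0)
    (hbit.comp (Primrec.fst.comp Primrec.snd) (Primrec.snd.comp Primrec.snd)).to₂

/-- The label written on a certificate. A bit string on which no label is written is read as an
arbitrary default label, whose contents the verifier tests like those of any other. -/
def Certificate.toLabel (l : Certificate) : Label := (Encodable.decode l.toNat).getD default

/-- The certificate on which a label is written. -/
def Label.toCertificate (L : Label) : Certificate := (Encodable.encode L).bits

theorem Label.toLabel_toCertificate (L : Label) : L.toCertificate.toLabel = L := by
  simp [toCertificate, Certificate.toLabel, Certificate.toNat_bits]

theorem Label.length_toCertificate_le_iff :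
    L.toCertificate.length ≤ k ↔ Encodable.encode L < 2 ^ k := by
  rw [toCertificate, Nat.size_eq_bits_len, Nat.size_le]

theorem Certificate.primrec_toLabel : Primrec Certificate.toLabel :=
  Primrec.option_getD.comp (Primrec.decode.comp primrec_toNat) (Primrec.const default)

namespace Label

variable {M : Multiset Label}

/-- The labels in `M` of the nodes on the side opposite to that of a node labeled `L`. -/
def opposite (L : Label) (M : Multiset Label) : Multiset Label := M.filter (·.side ≠ L.side)

/-- The labels in `M` of the nodes on the same side as a node labeled `L`. -/
def same (L : Label) (M : Multiset Label) : Multiset Label := M.filter (·.side = L.side)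

/-- Two labels are adjacent when their points are adjacent in `crossingGraph`. -/
def crossing : SimpleGraph Label := (crossingGraph ℕ ℕ).comap point

instance : DecidableRel crossing.Adj :=
  fun K N => inferInstanceAs (Decidable ((crossingGraph ℕ ℕ).Adj K.point N.point))

/-- The test carried out by a node with identifier `i` and label `L` whose neighbors have the
labels `M`. -/
structure IsConsistent (i : ℕ) (L : Label) (M : Multiset Label) : Prop where
  ident_eq : L.ident = i
  hub_eq : ∀ K ∈ M, K.hub = L.hub
  count_eq : ∀ K ∈ M, K.count = L.count
  exists_hub : ∃ K ∈ L.opposite M, K.ident = L.hub L.side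
  card_opposite : (L.opposite M).card = L.count L.side
  card_same : (L.same M).card = L.degree
  crossing_same : ∀ K ∈ L.same M, crossing.Adj L K
  card_crossing : ∀ K ∈ L.opposite M, ((L.opposite M).filter (crossing.Adj K)).card = K.degree
  inducedP4Free : ∀ p ∈ L.opposite M, ∀ q ∈ L.opposite M, ∀ r ∈ L.opposite M, ∀ s ∈ L.opposite M,
    ¬ IsInducedP4 crossing p q r s

section Computability

variable {α : Type*} [Primcodable α] {l : α → Label} {m : α → List Label}

theorem primrecRel_crossing : PrimrecRel crossing.Adj :=
  primrecRel_crossingGraph.comp (primrec_point.comp Primrec.fst) (primrec_point.comp Primrec.snd)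

theorem primrecRel_side_eq (hl : Primrec l) :
    PrimrecRel fun (x : α) (K : Label) => K.side = (l x).side :=
  Primrec.eq.comp (primrec_side.comp Primrec.snd) (primrec_side.comp (hl.comp Primrec.fst))

theorem primrecPred_forall_eq {f : Label → Bool → ℕ} (hf : Primrec₂ f) (hl : Primrec l)
    (hm : Primrec m) : PrimrecPred fun x => ∀ K ∈ m x, f K = f (l x) := by
  have h (b : Bool) : PrimrecRel fun (x : α) (K : Label) => f K b = f (l x) b :=
    Primrec.eq.comp (hf.comp Primrec.snd (Primrec.const b))
      (hf.comp (hl.comp Primrec.fst) (Primrec.const b))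
  exact primrecPred_forall_mem hm (((h false).and (h true)).of_eq fun x => by
    simp only [funext_iff, Bool.forall_bool])

end Computability

theorem primrecPred_isConsistent : PrimrecPred fun x : ℕ × Label × List Label =>
    IsConsistent x.1 x.2.1 (x.2.2 : Multiset Label) := by
  have hl : Primrec fun x : ℕ × Label × List Label => x.2.1 := Primrec.fst.comp Primrec.snd
  have hm : Primrec fun x : ℕ × Label × List Label => x.2.2 := Primrec.snd.comp Primrec.snd
  have hsame := primrec_filter hm (primrecRel_side_eq hl)
  have hopp := primrec_filter hm (primrecRel_side_eq hl).not
  refine .of_eq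
    (.and ?_ <| .and ?_ <| .and ?_ <| .and ?_ <| .and ?_ <| .and ?_ <| .and ?_ <| .and ?_ ?_)
    fun x => ⟨fun ⟨h₁, h₂, h₃, h₄, h₅, h₆, h₇, h₈, h₉⟩ => ⟨h₁, h₂, h₃, h₄, h₅, h₆, h₇, h₈, h₉⟩,
      fun ⟨h₁, h₂, h₃, h₄, h₅, h₆, h₇, h₈, h₉⟩ => ⟨h₁, h₂, h₃, h₄, h₅, h₆, h₇, h₈, h₉⟩⟩
  · exact Primrec.eq.comp (primrec_ident.comp hl) Primrec.fst
  · exact primrecPred_forall_eq primrec_hub hl hm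
  · exact primrecPred_forall_eq primrec_count hl hm
  · exact primrecPred_exists_mem hopp (Primrec.eq.comp (primrec_ident.comp Primrec.snd)
      ((primrec_hub.comp hl (primrec_side.comp hl)).comp Primrec.fst))
  · exact Primrec.eq.comp (Primrec.list_length.comp hopp)
      (primrec_count.comp hl (primrec_side.comp hl))
  · exact Primrec.eq.comp (Primrec.list_length.comp hsame) (primrec_degree.comp hl)
  · exact primrecPred_forall_mem hsame (primrecRel_crossing.comp (hl.comp Primrec.fst) Primrec.snd)
  · exact primrecPred_forall_mem hopp (Primrec.eq.comp (Primrec.list_length.comp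
      (primrec_filter (hopp.comp Primrec.fst) (primrecRel_crossing.comp
        (Primrec.snd.comp Primrec.fst) Primrec.snd))) (primrec_degree.comp Primrec.snd))
  · exact primrecPred_forall_not_isInducedP4 primrecRel_crossing hopp

end Label

open Classical in
/-- The verifier of the scheme. A node without neighbors accepts, since it is then alone in the
graph; the other nodes run the test `Label.IsConsistent`. -/
noncomputable def cographVerifier : Verifier where
  output i l m := decide (m = 0 ∨ Label.IsConsistent i l.toLabel (m.map Certificate.toLabel))
  computable := by
    have hnil : PrimrecPred fun x : ℕ × Certificate × List Certificate => x.2.2 = [] :=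
      Primrec.eq.comp (Primrec.snd.comp Primrec.snd) (Primrec.const [])
    have hlabels : Primrec fun x : ℕ × Certificate × List Certificate =>
        (x.1, x.2.1.toLabel, x.2.2.map Certificate.toLabel) :=
      Primrec.fst.pair <| (Certificate.primrec_toLabel.comp (Primrec.fst.comp Primrec.snd)).pair <|
        Primrec.list_map (Primrec.snd.comp Primrec.snd)
          (Certificate.primrec_toLabel.comp Primrec.snd)
    obtain ⟨_, h⟩ := hnil.or (Label.primrecPred_isConsistent.comp hlabels)
    exact h.to_comp.of_eq fun x => by simp

section Labeling

variable {V : Type*} [Fintype V] {G : SimpleGraph V} {label : V → Label} {v : V}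

open Classical in
/-- The labels of the neighbors of `v`. -/
noncomputable def neighborLabels (G : SimpleGraph V) (label : V → Label) (v : V) : Multiset Label :=
  (Finset.univ.filter fun w => G.Adj v w).val.map label

theorem mem_neighborLabels {K : Label} :
    K ∈ neighborLabels G label v ↔ ∃ w, G.Adj v w ∧ label w = K := by
  simp [neighborLabels]

theorem mem_opposite_neighborLabels {K L : Label} : K ∈ L.opposite (neighborLabels G label v) ↔
    ∃ w, G.Adj v w ∧ (label w).side ≠ L.side ∧ label w = K := by
  simp only [Label.opposite, Multiset.mem_filter, mem_neighborLabels]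
  exact ⟨fun ⟨⟨w, hw, hwK⟩, hside⟩ => ⟨w, hw, hwK ▸ hside, hwK⟩,
    fun ⟨w, hw, hside, hwK⟩ => ⟨⟨w, hw, hwK⟩, hwK ▸ hside⟩⟩

theorem mem_same_neighborLabels {K L : Label} : K ∈ L.same (neighborLabels G label v) ↔
    ∃ w, G.Adj v w ∧ (label w).side = L.side ∧ label w = K := by
  simp only [Label.same, Multiset.mem_filter, mem_neighborLabels]
  exact ⟨fun ⟨⟨w, hw, hwK⟩, hside⟩ => ⟨w, hw, hwK ▸ hside, hwK⟩,
    fun ⟨w, hw, hside, hwK⟩ => ⟨⟨w, hw, hwK⟩, hwK ▸ hside⟩⟩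

theorem card_filter_neighborLabels (p : Label → Prop) [DecidablePred p]
    [DecidablePred fun w => G.Adj v w ∧ p (label w)] :
    ((neighborLabels G label v).filter p).card =
      (Finset.univ.filter fun w => G.Adj v w ∧ p (label w)).card := by
  classical
  rw [neighborLabels, Multiset.filter_map, Multiset.card_map, ← Finset.filter_val,
    ← Finset.card_def, Finset.filter_filter]
  simp only [Function.comp_apply]

/-- All nodes pass the test, with `ident` as their identifiers and `label` as their labels. -/
def IsConsistentLabeling (G : SimpleGraph V) (ident : V → ℕ) (label : V → Label) : Prop :=
  ∀ v, (label v).IsConsistent (ident v) (neighborLabels G label v)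

end Labeling

theorem acceptsAt_cographVerifier {V : Type u} [Fintype V] {G : SimpleGraph V} {ident : V → ℕ}
    {cert : V → Certificate} {v : V} : cographVerifier.AcceptsAt G ident cert v ↔
      (∀ w, ¬ G.Adj v w) ∨ Label.IsConsistent (ident v) (cert v).toLabel
        (neighborLabels G (fun w => (cert w).toLabel) v) := by
  simp [Verifier.AcceptsAt, cographVerifier, received, neighborLabels]

theorem bool_ne_iff_eq {a b c : Bool} (h : b ≠ c) : a ≠ c ↔ a = b := by
  revert a b c
  decide

section Soundness

variable {V : Type*} [Fintype V] {G : SimpleGraph V}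

/-- The hub `r` of the side of `v` has the whole side as neighbors. The neighbors of `u` on that
side are as many, so they are the whole side too. -/
theorem adj_of_side_ne [DecidableRel G.Adj] {side : V → Bool}
    (hhub : ∀ v, ∃ r, side r ≠ side v ∧ ∀ u, side u = side v → G.Adj r u)
    (hcard : ∀ u v, side u = side v →
      (Finset.univ.filter fun w => G.Adj u w ∧ side w ≠ side u).card =
        (Finset.univ.filter fun w => G.Adj v w ∧ side w ≠ side v).card)
    {u v : V} (huv : side u ≠ side v) : G.Adj u v := by
  obtain ⟨r, hr, hadj⟩ := hhub v
  have hur : side u = side r := (bool_ne_iff_eq hr).1 huv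
  have hsub : (Finset.univ.filter fun w => G.Adj u w ∧ side w ≠ side u) ⊆
      Finset.univ.filter fun w => G.Adj r w ∧ side w ≠ side r := fun w hw => by
    rw [Finset.mem_filter] at hw ⊢
    rw [← hur]
    exact ⟨hw.1, hadj w ((bool_ne_iff_eq huv.symm).1 hw.2.2), hw.2.2⟩
  have hv : v ∈ Finset.univ.filter fun w => G.Adj r w ∧ side w ≠ side r := by
    simpa using ⟨hadj v rfl, hr.symm⟩
  rw [← Finset.eq_of_subset_of_card_le hsub (hcard u r hur).ge] at hv
  exact (Finset.mem_filter.1 hv).2.1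

namespace IsConsistentLabeling

variable {ident : V → ℕ} {label : V → Label}

theorem hub_eq (h : IsConsistentLabeling G ident label) (hG : G.Preconnected) (u v : V) :
    (label u).hub = (label v).hub :=
  eq_of_forall_adj_eq hG (f := fun v => (label v).hub) (fun u v huv =>
    ((h u).hub_eq _ (mem_neighborLabels.2 ⟨v, huv, rfl⟩)).symm) u v

theorem count_eq (h : IsConsistentLabeling G ident label) (hG : G.Preconnected) (u v : V) :
    (label u).count = (label v).count :=
  eq_of_forall_adj_eq hG (f := fun v => (label v).count) (fun u v huv =>
    ((h u).count_eq _ (mem_neighborLabels.2 ⟨v, huv, rfl⟩)).symm) u v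

theorem exists_hub (h : IsConsistentLabeling G ident label) (hG : G.Preconnected)
    (hident : Function.Injective ident) (v : V) :
    ∃ r, (label r).side ≠ (label v).side ∧ ∀ u, (label u).side = (label v).side → G.Adj r u := by
  have exists_adj (u : V) : ∃ r, G.Adj u r ∧ (label r).side ≠ (label u).side ∧
      ident r = (label u).hub (label u).side := by
    obtain ⟨K, hK, hhub⟩ := (h u).exists_hub
    obtain ⟨r, hr, hside, rfl⟩ := mem_opposite_neighborLabels.1 hK
    exact ⟨r, hr, hside, (h r).ident_eq ▸ hhub⟩
  obtain ⟨r, -, hrv, hr⟩ := exists_adj v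
  refine ⟨r, hrv, fun u hu => ?_⟩
  obtain ⟨r', hur', -, hr'⟩ := exists_adj u
  obtain rfl : r' = r := hident (by rw [hr, hr', h.hub_eq hG u v, hu])
  exact hur'.symm

theorem adj_of_side_ne (h : IsConsistentLabeling G ident label) (hG : G.Preconnected)
    (hident : Function.Injective ident) {u v : V} (huv : (label u).side ≠ (label v).side) :
    G.Adj u v := by
  classical
  refine PLS.adj_of_side_ne (side := fun v => (label v).side) (h.exists_hub hG hident)
    (fun u v huv => ?_) huv
  have hu := (h u).card_opposite
  have hv := (h v).card_opposite
  rw [Label.opposite, card_filter_neighborLabels] at hu hv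
  rw [hu, hv, h.count_eq hG u v, huv]

/-- A node `r` on the other side checks that `degree` counts the nodes on the side of `u` whose
labels cross that of `u`. All neighbors of `u` on its side are among them, and `degree` counts these
neighbors as well. -/
theorem adj_iff_crossing (h : IsConsistentLabeling G ident label) (hG : G.Preconnected)
    (hident : Function.Injective ident) {u w : V} (hwu : (label w).side = (label u).side) :
    G.Adj u w ↔ Label.crossing.Adj (label u) (label w) := by
  classical
  obtain ⟨r, hru, hadj⟩ := h.exists_hub hG hident u
  have side_ne_iff (x : V) : (label x).side ≠ (label r).side ↔ (label x).side = (label u).side :=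
    bool_ne_iff_eq hru.symm
  have hsub : (Finset.univ.filter fun x => G.Adj u x ∧ (label x).side = (label u).side) ⊆
      Finset.univ.filter fun x => G.Adj r x ∧
        Label.crossing.Adj (label u) (label x) ∧ (label x).side ≠ (label r).side := fun x hx => by
    simp only [Finset.mem_filter, Finset.mem_univ, true_and, side_ne_iff] at hx ⊢
    exact ⟨hadj x hx.2, (h u).crossing_same _ (mem_same_neighborLabels.2 ⟨x, hx.1, hx.2, rfl⟩),
      hx.2⟩
  have hcard_same := (h u).card_same
  have hcard_crossing := (h r).card_crossing (label u)
    (mem_opposite_neighborLabels.2 ⟨u, hadj u rfl, hru.symm, rfl⟩)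
  rw [Label.same, card_filter_neighborLabels] at hcard_same
  rw [Label.opposite, Multiset.filter_filter, card_filter_neighborLabels] at hcard_crossing
  have heq := Finset.eq_of_subset_of_card_le hsub (hcard_crossing.trans hcard_same.symm).le
  simpa [side_ne_iff, hwu, hadj w hwu] using Finset.ext_iff.1 heq w

theorem inducedP4Free (h : IsConsistentLabeling G ident label) (hG : G.Preconnected)
    (hident : Function.Injective ident) : InducedP4Free V G := by
  have hjoin {u v : V} : (label u).side ≠ (label v).side → G.Adj u v := h.adj_of_side_ne hG hident
  refine inducedP4Free_iff.2 fun a b c d hP => ?_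
  obtain ⟨hb, hc, hd⟩ := hP.map_eq (f := fun v => (label v).side) fun u v => hjoin
  obtain ⟨r, hra, hadj⟩ := h.exists_hub hG hident a
  have mem_opposite {u : V} (hu : (label u).side = (label a).side) :
      label u ∈ (label r).opposite (neighborLabels G label r) :=
    mem_opposite_neighborLabels.2 ⟨u, hadj u hu, hu ▸ hra.symm, rfl⟩
  have adj_iff {u w : V} (hu : (label u).side = (label a).side)
      (hw : (label w).side = (label a).side) :
      G.Adj u w ↔ Label.crossing.Adj (label u) (label w) :=
    h.adj_iff_crossing hG hident (hw.trans hu.symm)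
  refine (h r).inducedP4Free _ (mem_opposite rfl) _ (mem_opposite hb) _ (mem_opposite hc) _
    (mem_opposite hd) ?_
  rwa [IsInducedP4, adj_iff rfl hb, adj_iff hb hc, adj_iff hc hd, adj_iff rfl hc, adj_iff hb hd,
    adj_iff rfl hd] at hP

end IsConsistentLabeling

end Soundness

theorem inducedP4Free_of_acceptsAt {V : Type u} [Fintype V] {G : SimpleGraph V} {ident : V → ℕ}
    {cert : V → Certificate} (hG : G.Preconnected) (hident : Function.Injective ident)
    (h : ∀ v, cographVerifier.AcceptsAt G ident cert v) : InducedP4Free V G := by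
  obtain _ | _ := subsingleton_or_nontrivial V
  · exact inducedP4Free_iff.2 fun a b c d hP => hP.1.ne (Subsingleton.elim _ _)
  · have consistent : IsConsistentLabeling G ident fun v => (cert v).toLabel := fun v => by
      obtain ⟨w, hvw⟩ := hG.exists_adj_of_nontrivial v
      exact (acceptsAt_cographVerifier.1 (h v)).resolve_left fun hv => hv w hvw
    exact consistent.inducedP4Free hG hident

section Completeness

variable {V : Type*} [Fintype V] {G : SimpleGraph V} {ident : V → ℕ} {side : V → Bool}
  {rep : Bool → V} {p : V → ℕ × ℕ}

open Classical in
/-- The label given to `v` by the prover for a join with the two sides `side`, in which `rep b` is a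
node of side `b`, and a permutation model `p`. -/
noncomputable def proverLabel (G : SimpleGraph V) (ident : V → ℕ) (side : V → Bool)
    (rep : Bool → V) (p : V → ℕ × ℕ) (v : V) : Label where
  hub b := ident (rep !b)
  count b := (Finset.univ.filter fun w => side w ≠ b).card
  side := side v
  ident := ident v
  degree := (Finset.univ.filter fun w => G.Adj v w ∧ side w = side v).card
  point := p v

theorem crossing_proverLabel_iff (hp : IsPermutationModel G Finset.univ p) (u w : V) :
    Label.crossing.Adj (proverLabel G ident side rep p u) (proverLabel G ident side rep p w) ↔
      G.Adj u w :=
  (hp.adj_iff u (Finset.mem_univ u) w (Finset.mem_univ w)).symm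

theorem isConsistentLabeling_proverLabel (hG : InducedP4Free V G)
    (hjoin : ∀ u v, side u ≠ side v → G.Adj u v) (hrep : ∀ b, side (rep b) = b)
    (hp : IsPermutationModel G Finset.univ p) :
    IsConsistentLabeling G ident (proverLabel G ident side rep p) := by
  classical
  intro v
  constructor
  case ident_eq => rfl
  case hub_eq | count_eq =>
    intro K hK
    obtain ⟨w, -, rfl⟩ := mem_neighborLabels.1 hK
    rfl
  case exists_hub =>
    have hside : side (rep !side v) ≠ side v := by simp [hrep]
    exact ⟨_, mem_opposite_neighborLabels.2 ⟨_, (hjoin _ _ hside).symm, hside, rfl⟩, rfl⟩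
  case card_opposite =>
    rw [Label.opposite, card_filter_neighborLabels]
    refine congrArg Finset.card (Finset.filter_congr fun w _ => ?_)
    exact and_iff_right_of_imp fun hw => (hjoin _ _ hw).symm
  case card_same =>
    rw [Label.same, card_filter_neighborLabels]
    exact congrArg Finset.card (Finset.filter_congr fun w _ => Iff.rfl)
  case crossing_same =>
    intro K hK
    obtain ⟨w, hw, -, rfl⟩ := mem_same_neighborLabels.1 hK
    exact (crossing_proverLabel_iff hp v w).2 hw
  case card_crossing =>
    intro K hK
    obtain ⟨u, -, hside, rfl⟩ := mem_opposite_neighborLabels.1 hK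
    rw [Label.opposite, Multiset.filter_filter, card_filter_neighborLabels]
    refine congrArg Finset.card (Finset.filter_congr fun w _ => ?_)
    rw [crossing_proverLabel_iff hp, bool_ne_iff_eq hside]
    exact and_iff_right_of_imp fun hw => (hjoin _ _ ((bool_ne_iff_eq hside).2 hw.2)).symm
  case inducedP4Free =>
    intro _ ha _ hb _ hc _ hd hP
    obtain ⟨a, -, -, rfl⟩ := mem_opposite_neighborLabels.1 ha
    obtain ⟨b, -, -, rfl⟩ := mem_opposite_neighborLabels.1 hb
    obtain ⟨c, -, -, rfl⟩ := mem_opposite_neighborLabels.1 hc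
    obtain ⟨d, -, -, rfl⟩ := mem_opposite_neighborLabels.1 hd
    simp only [IsInducedP4, crossing_proverLabel_iff hp] at hP
    exact inducedP4Free_iff.1 hG a b c d hP

theorem encode_proverLabel_lt {k : ℕ} (hk : 1 ≤ k) (hcard : Fintype.card V < 2 ^ k)
    (hident : ∀ v, ident v < 2 ^ k) (hp : IsPermutationModel G Finset.univ p) (v : V) :
    Encodable.encode (proverLabel G ident side rep p v) < 2 ^ (16 * k) :=
  Label.encode_lt hk (fun _ => hident _) (fun _ => (Finset.card_le_univ _).trans_lt hcard)
    (hident v) ((Finset.card_le_univ _).trans_lt hcard)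
    ((hp.fst_lt v (Finset.mem_univ v)).trans hcard) ((hp.snd_lt v (Finset.mem_univ v)).trans hcard)

end Completeness

theorem exists_acceptsAt {V : Type u} [Fintype V] {G : SimpleGraph V} {ident : V → ℕ}
    (hG : InducedP4Free V G) (hconn : G.Preconnected) {k : ℕ} (hk : 1 ≤ k)
    (hcard : Fintype.card V < 2 ^ k) (hident : ∀ v, ident v < 2 ^ k) :
    ∃ cert : V → Certificate, (∀ v, (cert v).length ≤ 16 * k) ∧
      ∀ v, cographVerifier.AcceptsAt G ident cert v := by
  obtain _ | _ := subsingleton_or_nontrivial V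
  · exact ⟨fun _ => [], by simp, fun v => acceptsAt_cographVerifier.2 <| .inl fun w hw =>
      hw.ne (Subsingleton.elim v w)⟩
  obtain ⟨side, hside, hjoin⟩ := hG.exists_join hconn
  obtain ⟨p, hp⟩ := hG.exists_isPermutationModel Finset.univ
  choose rep hrep using hside
  refine ⟨fun v => (proverLabel G ident side rep p v).toCertificate, fun v => ?_, fun v => ?_⟩
  · exact Label.length_toCertificate_le_iff.2 (encode_proverLabel_lt hk hcard hident hp v)
  · rw [acceptsAt_cographVerifier]
    simp only [Label.toLabel_toCertificate]
    exact .inr (isConsistentLabeling_proverLabel hG hjoin hrep hp v)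

theorem isBigO_mul_size (C : ℕ) :
    (fun n => ((C * Nat.size n : ℕ) : ℝ)) =O[atTop] fun n : ℕ => Real.log n := by
  have hlog2 : 0 < Real.log 2 := Real.log_pos one_lt_two
  refine IsBigO.of_bound (C * (2 / Real.log 2)) ?_
  filter_upwards [eventually_ge_atTop 2] with n hn
  have hlog : Real.log 2 ≤ Real.log n := Real.log_le_log two_pos (mod_cast hn)
  have hnat : (Nat.log 2 n : ℝ) ≤ Real.log n / Real.log 2 := by
    rw [Real.log_div_log]
    exact_mod_cast Real.natLog_le_logb n 2
  have hsize : (Nat.size n : ℝ) ≤ Nat.log 2 n + 1 :=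
    mod_cast Nat.size_le.2 (Nat.lt_pow_succ_log_self one_lt_two n)
  have hone : 1 ≤ Real.log n / Real.log 2 := (one_le_div hlog2).2 hlog
  rw [Real.norm_of_nonneg (Nat.cast_nonneg _), Real.norm_of_nonneg (hlog2.le.trans hlog)]
  push_cast
  calc (C : ℝ) * Nat.size n
      ≤ C * (Real.log n / Real.log 2 + Real.log n / Real.log 2) := by gcongr; linarith
    _ = C * (2 / Real.log 2) * Real.log n := by ring

theorem cographVerifier_certifies {c : ℕ} (hc : 1 ≤ c) :
    cographVerifier.Certifies c (fun n => 16 * c * Nat.size n) InducedP4Free.{u} := by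
  intro V _ G ident hconn hident
  refine ⟨fun hG => ?_, fun hG cert => ?_⟩
  · have : Nonempty V := hconn.nonempty
    have hcard : Fintype.card V ^ c < 2 ^ (c * Nat.size (Fintype.card V)) := by
      rw [mul_comm, pow_mul]
      exact Nat.pow_lt_pow_left (Nat.lt_size_self _) (Nat.one_le_iff_ne_zero.1 hc)
    have hsize : 1 ≤ Nat.size (Fintype.card V) := Nat.size_pos.2 Fintype.card_pos
    simp only [mul_assoc]
    exact exists_acceptsAt hG hconn.preconnected (Nat.mul_pos hc hsize)
      ((Nat.le_self_pow (by lia) _).trans_lt hcard) fun v => (hident.2 v).2.trans_lt hcard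
  · by_contra! h
    exact hG (inducedP4Free_of_acceptsAt hconn.preconnected hident.1 h)

end PLS

theorem mainTheorem3 :
    ∃ A : PLS.Verifier, ∀ c : ℕ, 1 ≤ c →
      ∃ s : ℕ → ℕ, (fun n => (s n : ℝ)) =O[atTop] (fun n : ℕ => Real.log (n : ℝ)) ∧
        A.Certifies c s InducedP4Free.{u} :=
  ⟨PLS.cographVerifier, fun c hc =>
    ⟨_, PLS.isBigO_mul_size (16 * c), PLS.cographVerifier_certifies hc⟩⟩
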